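/- An oriented graph is a digraph obtained from a finite simple undirected graph by choosing one orientation for each edge. Let $\overrightarrow{S_{3,1}}$ be the 1-subdivision of the in-star with three leaves, i.e. the digraph on seven vertices $v,u_1,u_2,u_3,w_1,w_2,w_3$ with arcs $w_iu_i$ and $u_iv$ for $i=1,2,3$. Let $ex_{ori}(n,\overrightarrow{S_{3,1}})$ be the maximum number of arcs in an oriented graph on $n$ vertices that contains no (not necessarily induced) subgraph isomorphic to $\overrightarrow{S_{3,1}}$, and let $EX_{ori}(n,\overrightarrow{S_{3,1}})$ be the set of such oriented graphs on $n$ vertices attaining this maximum. Theorem. Let $n\ge 40$ be an integer. Then $$ex_{ori}(n,\overrightarrow{S_{3,1}})=\left\lfloor\frac{(n+2)^2}{4}\right\rfloor.$$ Moreover, an oriented graph $D$ on $n$ vertices, with vertex set $V(D)$ and arc set $A(D)$, belongs to $EX_{ori}(n,\overrightarrow{S_{3,1}})$ if and only if $V(D)$ has a partition $V(D)=X\cup Y$ such that (i) $|X|\in\{\lfloor n/2\rfloor-1,\ \lceil n/2\rceil-1\}$; (ii) $xy\in A(D)$ for all $x\in X$, $y\in Y$; (iii) the induced subgraph $D[X]$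 has no arcs, and every vertex of the induced subgraph $D[Y]$ has in-degree exactly $2$ in $D[Y]$. -/

import Mathlib

namespace Digraph

/-- An oriented graph: a digraph obtained by orienting each edge of a simple undirected graph,
i.e. for all `u`, `v` at most one of `uv`, `vu` is an arc; in particular there are no loops. -/
def IsOriented {V : Type*} (D : Digraph V) : Prop :=
  ∀ u v, D.Adj u v → ¬ D.Adj v u

/-- The size of a digraph: its number of arcs. -/
noncomputable def size {V : Type*} (D : Digraph V) : ℕ :=
  {p : V × V | D.Adj p.1 p.2}.ncard

/-- The in-degree of a vertex: its number of in-neighbors. -/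
noncomputable def inDegree {V : Type*} (D : Digraph V) (v : V) : ℕ :=
  {u | D.Adj u v}.ncard

/-- All vertices have in-degree `k`. -/
def IsInDegreeRegular {V : Type*} (D : Digraph V) (k : ℕ) : Prop :=
  ∀ v, D.inDegree v = k

/-- The subdigraph `D[S]` induced by a vertex set `S`. -/
def inducedOn {V : Type*} (D : Digraph V) (S : Set V) : Digraph S where
  Adj u v := D.Adj u v

/-- `D` contains a copy of `F`: a (not necessarily induced) subgraph isomorphic to `F`. -/
def ContainsCopy {V W : Type*} (D : Digraph V) (F : Digraph W) : Prop :=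
  ∃ f : W → V, Function.Injective f ∧ ∀ a b, F.Adj a b → D.Adj (f a) (f b)

/-- The in-star with `k` leaves: each of the `k` leaves `some i` has an arc to the
center `none`. It has order `k + 1`. -/
def inStar (k : ℕ) : Digraph (Option (Fin k)) where
  Adj u v := u ≠ none ∧ v = none

/-- The 1-subdivision of `D`: each arc `e = uv` is replaced by a directed path `u → e → v` through
a new vertex `e`. -/
def subdivision {V : Type*} (D : Digraph V) :
    Digraph (V ⊕ {p : V × V // D.Adj p.1 p.2}) where
  Adj
    | .inl u, .inr e => e.1.1 = u
    | .inr e, .inl v => e.1.2 = v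
    | _, _ => False

/-- The oriented Turán number: the maximum size of an `F`-free oriented graph of order `n`.
The sizes are bounded by `n ^ 2`, so the supremum is a maximum as soon as some `F`-free oriented
graph of order `n` exists. -/
noncomputable def exOri {W : Type*} (n : ℕ) (F : Digraph W) : ℕ :=
  sSup {m | ∃ D : Digraph (Fin n), D.IsOriented ∧ ¬ D.ContainsCopy F ∧ D.size = m}

/-- `D` is an extremal `F`-free oriented graph of order `n`. -/
def IsExtremalOri {V W : Type*} (D : Digraph V) (n : ℕ) (F : Digraph W) : Prop :=
  Nat.card V = n ∧ D.IsOriented ∧ ¬ D.ContainsCopy F ∧ D.size = exOri n F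

end Digraph

open Finset

namespace Digraph

/-! ### Disjoint arcs and copies of the subdivided in-star. -/

section Basic

variable {V : Type*} {D : Digraph V}

/-! Call a vertex heavy if its in-degree is at least 5 and light otherwise, with b heavy and s light
vertices, b + s = n. A heavy in-neighbour of v extends greedily to an arc avoiding two given arcs,
so three heavy in-neighbours of v would produce a copy: every vertex has at most two
(`degFrom_heavy_five_le`). Counting in-arcs vertex by vertex gives size = b(s + 2) - (total defect
of heavy vertices) + (number of light arcs), which is `size_add_sum_defect`. Since b + (s + 2) = n +
2, the product is at most (n + 2)²/4, so everything reduces to showing that a digraph at least this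
large has no light arcs.

Light arcs do not pay for themselves: k disjoint ones force a total defect of at least kb minus a
bounded amount (`card_mul_card_heavy_le`). At most three vertices have in-degree 3 or 4
(`card_medium_le`), so there are at most 2s + 6 light arcs, too few to compensate three disjoint
ones. Without three disjoint arcs the count drops, which rules out two; without two it drops again,
which rules out any (`not_three_disjoint`, `not_two_disjoint`, `lightArcs_eq_empty`).

Then every defect vanishes, X is the light set and Y the heavy set. An arc from Y back to a light u
would make the heavy in-neighbours of u induce a digraph with all in-degrees 2; this needs five
vertices, so u would be heavy. The lower bound joins an independent set to a circulant. -/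

/-- Two arcs without a common end. -/
def ArcDisjoint (e f : V × V) : Prop :=
  e.1 ≠ f.1 ∧ e.1 ≠ f.2 ∧ e.2 ≠ f.1 ∧ e.2 ≠ f.2

theorem ArcDisjoint.symm {e f : V × V} (h : ArcDisjoint e f) : ArcDisjoint f e :=
  ⟨h.1.symm, h.2.2.1.symm, h.2.1.symm, h.2.2.2.symm⟩

theorem IsOriented.ne (ho : D.IsOriented) {u v : V} (h : D.Adj u v) : u ≠ v := by
  rintro rfl
  exact ho _ _ h h

theorem containsCopy_subdivision_inStar {v : V} {u w : Fin 3 → V}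
    (hu : Function.Injective u) (hw : Function.Injective w) (huw : ∀ i j, u i ≠ w j)
    (hvu : ∀ i, v ≠ u i) (hvw : ∀ i, v ≠ w i)
    (h1 : ∀ i, D.Adj (u i) v) (h2 : ∀ i, D.Adj (w i) (u i)) :
    D.ContainsCopy (inStar 3).subdivision := by
  let f : Option (Fin 3) ⊕ {p : Option (Fin 3) × Option (Fin 3) // (inStar 3).Adj p.1 p.2} → V :=
    fun x => match x with
      | .inl none => v
      | .inl (some i) => w i
      -- Junk value: no arc of the in-star starts at its center.
      | .inr ⟨(none, _), _⟩ => v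
      | .inr ⟨(some i, _), _⟩ => u i
  refine ⟨f, ?_, ?_⟩
  · rintro ((_ | i) | ⟨⟨_ | i, b⟩, ha, hb⟩) ((_ | j) | ⟨⟨_ | j, c⟩, hc, hd⟩) hij
    all_goals first
      | rfl
      | exact absurd rfl ha
      | exact absurd rfl hc
      | exact absurd hij (hvw _)
      | exact absurd hij.symm (hvw _)
      | exact absurd hij (hvu _)
      | exact absurd hij.symm (hvu _)
      | exact absurd hij (huw _ _)
      | exact absurd hij.symm (huw _ _)
      | (have := hw hij; subst this; rfl)
      | (have := hu hij; simp only at hb hd; subst this hb hd; rfl)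
  · rintro (a | ⟨⟨a, b⟩, ha, hb⟩) (c | ⟨⟨c, d⟩, hc, hd⟩) h
    · exact h.elim
    · obtain rfl : c = a := h
      obtain ⟨i, rfl⟩ := Option.ne_none_iff_exists'.1 hc
      exact h2 i
    · obtain rfl : b = c := h
      obtain rfl : b = none := hb
      obtain ⟨i, rfl⟩ := Option.ne_none_iff_exists'.1 ha
      exact h1 i
    · exact h.elim

theorem exists_of_containsCopy (h : D.ContainsCopy (inStar 3).subdivision) :
    ∃ (v : V) (u : Fin 3 → V), Function.Injective u ∧ (∀ i, D.Adj (u i) v) ∧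
      ∀ i, ∃ w, D.Adj w (u i) := by
  obtain ⟨f, hf, h⟩ := h
  have hs (i : Fin 3) : (inStar 3).Adj (some i) none := ⟨by simp, rfl⟩
  refine ⟨f (.inl none), fun i => f (.inr ⟨(some i, none), hs i⟩), ?_, ?_, ?_⟩
  · intro i j hij
    simpa using hf hij
  · intro i
    exact h _ _ rfl
  · intro i
    exact ⟨f (.inl (some i)), h _ _ rfl⟩

/-- Three pairwise disjoint arcs whose heads are in-neighbours of a common vertex form a copy. -/
theorem IsOriented.false_of_arcs (ho : D.IsOriented)
    (hF : ¬ D.ContainsCopy (inStar 3).subdivision) {v u₁ u₂ u₃ w₁ w₂ w₃ : V}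
    (a₁ : D.Adj w₁ u₁) (a₂ : D.Adj w₂ u₂) (a₃ : D.Adj w₃ u₃)
    (h₁ : D.Adj u₁ v) (h₂ : D.Adj u₂ v) (h₃ : D.Adj u₃ v)
    (d₁₂ : ArcDisjoint (w₁, u₁) (w₂, u₂)) (d₁₃ : ArcDisjoint (w₁, u₁) (w₃, u₃))
    (d₂₃ : ArcDisjoint (w₂, u₂) (w₃, u₃)) : False := by
  have e₁ := ho.ne a₁
  have e₂ := ho.ne a₂
  have e₃ := ho.ne a₃
  obtain ⟨x1, x2, x3, x4⟩ := d₁₂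
  obtain ⟨y1, y2, y3, y4⟩ := d₁₃
  obtain ⟨z1, z2, z3, z4⟩ := d₂₃
  refine hF (containsCopy_subdivision_inStar (v := v) (u := ![u₁, u₂, u₃]) (w := ![w₁, w₂, w₃])
    ?_ ?_ ?_ ?_ ?_ ?_ ?_)
  · intro i j; fin_cases i <;> fin_cases j <;> simp_all [eq_comm]
  · intro i j; fin_cases i <;> fin_cases j <;> simp_all [eq_comm]
  · intro i j; fin_cases i <;> fin_cases j <;> simp_all [eq_comm]
  · intro i; fin_cases i
    exacts [(ho.ne h₁).symm, (ho.ne h₂).symm, (ho.ne h₃).symm]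
  · intro i; fin_cases i
    · rintro rfl; exact ho _ _ h₁ a₁
    · rintro rfl; exact ho _ _ h₂ a₂
    · rintro rfl; exact ho _ _ h₃ a₃
  · intro i; fin_cases i <;> assumption
  · intro i; fin_cases i <;> assumption

end Basic

/-! ### Heavy in-neighbours. -/

section Counting

open scoped Classical

variable {V : Type*} [Fintype V] {D : Digraph V}

/-- The number of in-neighbours of `v` in `A`. -/
noncomputable def degFrom (D : Digraph V) (A : Finset V) (v : V) : ℕ := #{u ∈ A | D.Adj u v}

/-- The vertices of in-degree at least `k`. -/
noncomputable def heavy (D : Digraph V) (k : ℕ) : Finset V := {v | k ≤ D.degFrom univ v}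

theorem mem_heavy {k : ℕ} {v : V} : v ∈ D.heavy k ↔ k ≤ D.degFrom univ v := by
  simp [heavy]

theorem size_eq_sum_degFrom : D.size = ∑ v, D.degFrom univ v := by
  have : {p : V × V | D.Adj p.1 p.2} = ((univ : Finset (V × V)).filter fun p => D.Adj p.1 p.2) := by
    ext; simp
  rw [size, this, Set.ncard_coe_finset, card_filter, Fintype.sum_prod_type_right]
  simp only [degFrom, card_filter]

theorem degFrom_add_degFrom_compl (A : Finset V) (v : V) :
    D.degFrom A v + D.degFrom Aᶜ v = D.degFrom univ v := by
  simp only [degFrom, card_filter]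
  exact sum_add_sum_compl A _

theorem exists_adj_notMem {k : ℕ} {v : V} (hv : v ∈ D.heavy k) (F : Finset V) (hF : #F < k) :
    ∃ w, D.Adj w v ∧ w ∉ F := by
  obtain ⟨w, hw, hwF⟩ := exists_mem_notMem_of_card_lt_card (hF.trans_le (mem_heavy.1 hv))
  exact ⟨w, by simpa using hw, hwF⟩

/-- A heavy in-neighbour can be completed to an arc avoiding two given arcs. -/
theorem exists_arc_avoiding {p : V} (hp : p ∈ D.heavy 5)
    {e f : V × V} (h₁ : p ≠ e.1) (h₂ : p ≠ e.2) (h₃ : p ≠ f.1) (h₄ : p ≠ f.2) :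
    ∃ w, D.Adj w p ∧ ArcDisjoint (w, p) e ∧ ArcDisjoint (w, p) f := by
  -- Four ends must be avoided, whence the threshold 5 for heaviness.
  obtain ⟨w, hw, hwF⟩ := exists_adj_notMem hp {e.1, e.2, f.1, f.2} (by
    have := card_le_four (a := e.1) (b := e.2) (c := f.1) (d := f.2); omega)
  simp only [mem_insert, mem_singleton, not_or] at hwF
  exact ⟨w, hw, ⟨hwF.1, hwF.2.1, h₁, h₂⟩, hwF.2.2.1, hwF.2.2.2, h₃, h₄⟩

variable (ho : D.IsOriented) (hF : ¬ D.ContainsCopy (inStar 3).subdivision)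

include ho hF

theorem false_of_heavy_arc_arc {v p : V} {e f : V × V} (hp : p ∈ D.heavy 5) (hpv : D.Adj p v)
    (he : D.Adj e.1 e.2) (hf : D.Adj f.1 f.2) (hev : D.Adj e.2 v) (hfv : D.Adj f.2 v)
    (h₁ : p ≠ e.1) (h₂ : p ≠ e.2) (h₃ : p ≠ f.1) (h₄ : p ≠ f.2) (hef : ArcDisjoint e f) :
    False := by
  obtain ⟨w, hw, h5, h6⟩ := exists_arc_avoiding hp h₁ h₂ h₃ h₄
  exact ho.false_of_arcs hF hw he hf hpv hev hfv h5 h6 hef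

theorem false_of_heavy_heavy_arc {v p q : V} {e : V × V} (hp : p ∈ D.heavy 5) (hpv : D.Adj p v)
    (hq : q ∈ D.heavy 5) (hqv : D.Adj q v) (hpq : p ≠ q)
    (he : D.Adj e.1 e.2) (hev : D.Adj e.2 v)
    (h₁ : p ≠ e.1) (h₂ : p ≠ e.2) (h₃ : q ≠ e.1) (h₄ : q ≠ e.2) : False := by
  obtain ⟨w, hw, hwF⟩ := exists_adj_notMem hq {e.1, e.2, p} (by
    have := card_le_three (a := e.1) (b := e.2) (c := p); omega)
  simp only [mem_insert, mem_singleton, not_or] at hwF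
  exact false_of_heavy_arc_arc ho hF (f := (w, q)) hp hpv he hw hev hqv h₁ h₂ (Ne.symm hwF.2.2) hpq
    ⟨Ne.symm hwF.1, h₃.symm, Ne.symm hwF.2.1, h₄.symm⟩

theorem false_of_heavy_heavy_heavy {v p q r : V} (hp : p ∈ D.heavy 5) (hpv : D.Adj p v)
    (hq : q ∈ D.heavy 5) (hqv : D.Adj q v) (hr : r ∈ D.heavy 5) (hrv : D.Adj r v)
    (hpq : p ≠ q) (hpr : p ≠ r) (hqr : q ≠ r) : False := by
  obtain ⟨w, hw, hwF⟩ := exists_adj_notMem hr {p, q} (by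
    have := card_le_two (a := p) (b := q); omega)
  simp only [mem_insert, mem_singleton, not_or] at hwF
  exact false_of_heavy_heavy_arc ho hF (e := (w, r)) hp hpv hq hqv hpq hw hrv (Ne.symm hwF.1) hpr
    (Ne.symm hwF.2) hqr

/-- Heavy in-neighbours of `w` and disjoint arcs between light vertices with heads in-neighbours
of `w` number at most two altogether. -/
theorem card_filter_add_degFrom_heavy_le (w : V) {M : Finset (V × V)}
    (hM : ∀ e ∈ M, D.Adj e.1 e.2 ∧ e.1 ∉ D.heavy 5 ∧ e.2 ∉ D.heavy 5)
    (hd : (M : Set (V × V)).Pairwise ArcDisjoint) :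
    #{e ∈ M | D.Adj e.2 w} + D.degFrom (D.heavy 5) w ≤ 2 := by
  by_contra! hlt
  have key : ∀ p ∈ D.heavy 5, ∀ e ∈ M, p ≠ e.1 ∧ p ≠ e.2 := fun p hp e he =>
    ⟨fun h => (hM e he).2.1 (h ▸ hp), fun h => (hM e he).2.2 (h ▸ hp)⟩
  unfold degFrom at hlt
  rcases Nat.lt_or_ge 2 (#{u ∈ D.heavy 5 | D.Adj u w}) with h3 | h3
  · obtain ⟨p, q, r, hp, hq, hr, h⟩ := two_lt_card_iff.1 h3
    simp only [mem_filter] at hp hq hr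
    exact false_of_heavy_heavy_heavy ho hF hp.1 hp.2 hq.1 hq.2 hr.1 hr.2 h.1 h.2.1 h.2.2
  rcases Nat.lt_or_ge 1 (#{u ∈ D.heavy 5 | D.Adj u w}) with h2 | h2
  · obtain ⟨p, q, hp, hq, h⟩ := one_lt_card_iff.1 h2
    obtain ⟨e, he⟩ := card_pos.1 (show 0 < #{e ∈ M | D.Adj e.2 w} by omega)
    simp only [mem_filter] at hp hq he
    exact false_of_heavy_heavy_arc ho hF hp.1 hp.2 hq.1 hq.2 h (hM e he.1).1 he.2
      (key p hp.1 e he.1).1 (key p hp.1 e he.1).2 (key q hq.1 e he.1).1 (key q hq.1 e he.1).2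
  rcases Nat.lt_or_ge 0 (#{u ∈ D.heavy 5 | D.Adj u w}) with h1 | h1
  · obtain ⟨p, hp⟩ := card_pos.1 h1
    obtain ⟨e, f, he, hf, h⟩ := one_lt_card_iff.1 (show 1 < #{e ∈ M | D.Adj e.2 w} by omega)
    simp only [mem_filter] at hp hf he
    exact false_of_heavy_arc_arc ho hF hp.1 hp.2 (hM e he.1).1 (hM f hf.1).1 he.2 hf.2
      (key p hp.1 e he.1).1 (key p hp.1 e he.1).2 (key p hp.1 f hf.1).1 (key p hp.1 f hf.1).2
      (hd he.1 hf.1 h)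
  · obtain ⟨e, f, g, he, hf, hg, h⟩ :=
      two_lt_card_iff.1 (show 2 < #{e ∈ M | D.Adj e.2 w} by omega)
    simp only [mem_filter] at he hf hg
    exact ho.false_of_arcs hF (hM e he.1).1 (hM f hf.1).1 (hM g hg.1).1 he.2 hf.2 hg.2
      (hd he.1 hf.1 h.1) (hd he.1 hg.1 h.2.1) (hd hf.1 hg.1 h.2.2)

theorem degFrom_heavy_five_le (w : V) : D.degFrom (D.heavy 5) w ≤ 2 := by
  simpa using card_filter_add_degFrom_heavy_le ho hF w (M := ∅) (by simp) (by simp)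

/-- In-degree 3 suffices when no arc goes backwards in the order a, b, c: choosing tails for c, then
b, then a, the absent arcs leave only two vertices to avoid each time. -/
theorem false_of_acyclic_triple {v a b c : V} (ha : a ∈ D.heavy 3) (hb : b ∈ D.heavy 3)
    (hc : c ∈ D.heavy 3) (hav : D.Adj a v) (hbv : D.Adj b v) (hcv : D.Adj c v)
    (hab : a ≠ b) (hac : a ≠ c) (hbc : b ≠ c)
    (h₁ : ¬ D.Adj b a) (h₂ : ¬ D.Adj c a) (h₃ : ¬ D.Adj c b) : False := by
  obtain ⟨z, hz, hzF⟩ := exists_adj_notMem hc {a, b} (by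
    have := card_le_two (a := a) (b := b); omega)
  obtain ⟨y, hy, hyF⟩ := exists_adj_notMem hb {a, z} (by
    have := card_le_two (a := a) (b := z); omega)
  obtain ⟨x, hx, hxF⟩ := exists_adj_notMem ha {y, z} (by
    have := card_le_two (a := y) (b := z); omega)
  simp only [mem_insert, mem_singleton, not_or] at hzF hyF hxF
  have hyc : y ≠ c := by rintro rfl; exact h₃ hy
  have hxb : x ≠ b := by rintro rfl; exact h₁ hx
  have hxc : x ≠ c := by rintro rfl; exact h₂ hx
  exact ho.false_of_arcs hF hx hy hz hav hbv hcv ⟨hxF.1, hxb, Ne.symm hyF.1, hab⟩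
    ⟨hxF.2, hxc, Ne.symm hzF.1, hac⟩ ⟨hyF.2, hyc, Ne.symm hzF.2, hbc⟩

/-- By the previous lemma, any three such in-neighbours of v form a cyclic triangle. Four vertices
cannot have all triples cyclic: if x → y, then y dominates both remaining vertices, and the triple
of y with these two is not cyclic. -/
theorem degFrom_heavy_three_le (v : V) : D.degFrom (D.heavy 3) v ≤ 3 := by
  by_contra! h
  obtain ⟨T, hT, hT4⟩ := exists_subset_card_eq (show 4 ≤ _ from h)
  have hmem : ∀ x ∈ T, x ∈ D.heavy 3 ∧ D.Adj x v := fun x hx => by simpa using hT hx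
  have acyc : ∀ a ∈ T, ∀ b ∈ T, ∀ c ∈ T, a ≠ b → a ≠ c → b ≠ c →
      D.Adj b a ∨ D.Adj c a ∨ D.Adj c b := by
    intro a ha b hb c hc hab hac hbc
    by_contra! hn
    exact false_of_acyclic_triple ho hF (hmem a ha).1 (hmem b hb).1 (hmem c hc).1 (hmem a ha).2
      (hmem b hb).2 (hmem c hc).2 hab hac hbc hn.1 hn.2.1 hn.2.2
  obtain ⟨a, b, c, d, hab, hac, had, hbc, hbd, hcd, rfl⟩ := card_eq_four.1 hT4
  have tri : ∀ x ∈ ({a, b, c, d} : Finset V), ∀ y ∈ ({a, b, c, d} : Finset V),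
      ∀ z ∈ ({a, b, c, d} : Finset V), x ≠ y → x ≠ z → y ≠ z → ¬ D.Adj y x →
      D.Adj y z ∧ D.Adj z x := by
    intro x hx y hy z hz hxy hxz hyz hn
    constructor
    · by_contra hyz'
      have := acyc x hx z hz y hy hxz hxy hyz.symm
      have := acyc z hz x hx y hy hxz.symm hyz.symm hxy
      have := ho z x
      grind
    · by_contra hyz'
      have := acyc x hx y hy z hz hxy hxz hyz
      have := acyc x hx z hz y hy hxz hxy hyz.symm
      have := ho y z
      grind
  have final : ∀ x ∈ ({a, b, c, d} : Finset V), ∀ y ∈ ({a, b, c, d} : Finset V),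
      ∀ z ∈ ({a, b, c, d} : Finset V), ∀ t ∈ ({a, b, c, d} : Finset V),
      x ≠ y → x ≠ z → x ≠ t → y ≠ z → y ≠ t → z ≠ t → ¬ D.Adj y x → False := by
    intro x hx y hy z hz t ht hxy hxz hxt hyz hyt hzt hn
    have h1 := tri x hx y hy z hz hxy hxz hyz hn
    have h2 := tri x hx y hy t ht hxy hxt hyt hn
    have h3 := acyc y hy z hz t ht hyz hyt hzt
    have h4 := acyc y hy t ht z hz hyt hyz hzt.symm
    have := ho _ _ h1.1
    have := ho _ _ h2.1
    have := ho z t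
    grind
  by_cases hba : D.Adj b a
  · exact final b (by simp) a (by simp) c (by simp) d (by simp) hab.symm hbc hbd hac had hcd
      (ho _ _ hba)
  · exact final a (by simp) b (by simp) c (by simp) d (by simp) hab hac had hbc hbd hcd hba

end Counting

/-! ### Sets of arcs with few disjoint members. -/

section ArcSets

open scoped Classical

variable {V : Type*} {D : Digraph V}

/-- The arcs of `F` incident with `z`. -/
noncomputable def arcsAt (F : Finset (V × V)) (z : V) : Finset (V × V) :=
  {e ∈ F | e.1 = z ∨ e.2 = z}

/-- The end of an arc at `z` other than `z`. -/
noncomputable def otherEnd (z : V) (e : V × V) : V := if e.1 = z then e.2 else e.1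

theorem IsOriented.injOn_otherEnd (ho : D.IsOriented) {F : Finset (V × V)}
    (hF : ∀ e ∈ F, D.Adj e.1 e.2) (z : V) : Set.InjOn (otherEnd z) (arcsAt F z) := by
  rintro ⟨a, b⟩ he ⟨c, d⟩ hf h
  simp only [arcsAt, coe_filter, Set.mem_ofPred_eq] at he hf
  have h1 := hF _ he.1
  have h2 := hF _ hf.1
  have := ho _ _ h1
  simp only [otherEnd] at h h1 h2
  simp only [Prod.mk.injEq]
  split_ifs at h <;> grind

theorem IsOriented.card_arcsAt_le (ho : D.IsOriented) {F : Finset (V × V)} {S : Finset V}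
    (hF : ∀ e ∈ F, D.Adj e.1 e.2 ∧ e.1 ∈ S ∧ e.2 ∈ S) (z : V) : #(arcsAt F z) ≤ #S - 1 := by
  by_cases hz : z ∈ S
  · rw [← card_erase_of_mem hz]
    refine card_le_card_of_injOn (otherEnd z) (fun e he => ?_)
      (ho.injOn_otherEnd (fun e he => (hF e he).1) z)
    simp only [arcsAt, coe_filter, Set.mem_ofPred_eq] at he
    obtain ⟨h1, h2, h3⟩ := hF e he.1
    have := ho.ne h1
    simp only [otherEnd, coe_erase, Set.mem_sdiff, Finset.mem_coe, Set.mem_singleton_iff]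
    split_ifs <;> grind
  · have : arcsAt F z = ∅ := by
      refine filter_eq_empty_iff.2 fun e he => ?_
      have := hF e he
      rintro (rfl | rfl) <;> tauto
    simp [this]

theorem IsOriented.exists_arcsAt_avoiding (ho : D.IsOriented) {F : Finset (V × V)}
    (hF : ∀ e ∈ F, D.Adj e.1 e.2) {z : V} {A : Finset V} (hA : #A < #(arcsAt F z)) :
    ∃ e ∈ arcsAt F z, otherEnd z e ∉ A := by
  rw [← card_image_of_injOn (ho.injOn_otherEnd hF z)] at hA
  obtain ⟨y, hy, hyA⟩ := exists_mem_notMem_of_card_lt_card hA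
  obtain ⟨e, he, rfl⟩ := mem_image.1 hy
  exact ⟨e, he, hyA⟩

theorem arcDisjoint_of_otherEnd {F : Finset (V × V)} {z : V} {e f : V × V} (he : e ∈ arcsAt F z)
    (h₁ : otherEnd z e ≠ f.1) (h₂ : otherEnd z e ≠ f.2) (h₃ : z ≠ f.1) (h₄ : z ≠ f.2) :
    ArcDisjoint e f := by
  simp only [arcsAt, mem_filter] at he
  simp only [otherEnd] at h₁ h₂
  unfold ArcDisjoint
  split_ifs at h₁ h₂ <;> grind

/-- Arcs on `S` no two of which are disjoint. -/
theorem IsOriented.card_le_of_no_two_disjoint (ho : D.IsOriented) {F : Finset (V × V)}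
    {S : Finset V} (hF : ∀ e ∈ F, D.Adj e.1 e.2 ∧ e.1 ∈ S ∧ e.2 ∈ S)
    (h : ∀ e ∈ F, ∀ f ∈ F, ¬ ArcDisjoint e f) : #F ≤ max 4 (#S - 1) := by
  -- An arc missing z meets at most two of the arcs at z, so three arcs at z force a star. Otherwise
  -- all arcs meet the ends of a fixed one, with at most two arcs at each end.
  by_cases hz : ∃ z, 3 ≤ #(arcsAt F z)
  · obtain ⟨z, hz⟩ := hz
    have : F = arcsAt F z := by
      refine (filter_eq_self.2 fun f hf => ?_).symm
      by_contra hn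
      push Not at hn
      obtain ⟨e, he, hA⟩ := ho.exists_arcsAt_avoiding (fun e he => (hF e he).1)
        (A := {f.1, f.2}) (z := z) (by have := card_le_two (a := f.1) (b := f.2); omega)
      simp only [mem_insert, mem_singleton, not_or] at hA
      exact h e (mem_filter.1 he).1 f hf
        (arcDisjoint_of_otherEnd he hA.1 hA.2 (Ne.symm hn.1) (Ne.symm hn.2))
    have h2 := ho.card_arcsAt_le hF z
    rw [← this] at h2
    exact h2.trans (le_max_right _ _)
  · push Not at hz
    rcases F.eq_empty_or_nonempty with rfl | ⟨e, he⟩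
    · simp
    have hsub : F ⊆ arcsAt F e.1 ∪ arcsAt F e.2 := by
      intro f hf
      have := h e he f hf
      simp only [ArcDisjoint, arcsAt, mem_union, mem_filter] at this ⊢
      grind
    have h1 := card_le_card hsub
    have h2 := card_union_le (arcsAt F e.1) (arcsAt F e.2)
    have h3 := hz e.1
    have h4 := hz e.2
    exact le_max_of_le_left (by omega)

/-- Arcs on `S` no three of which are pairwise disjoint. -/
theorem IsOriented.card_le_of_no_three_disjoint (ho : D.IsOriented) {F : Finset (V × V)}
    {S : Finset V} (hS : 10 ≤ #S) (hF : ∀ e ∈ F, D.Adj e.1 e.2 ∧ e.1 ∈ S ∧ e.2 ∈ S)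
    (h : ∀ e ∈ F, ∀ f ∈ F, ∀ g ∈ F, ArcDisjoint e f → ArcDisjoint e g → ¬ ArcDisjoint f g) :
    #F ≤ 2 * #S - 3 := by
  -- Five arcs at z include one disjoint from any two given arcs missing z, so the arcs missing z
  -- contain no disjoint pair, and the total is at most (#S - 1) + (#S - 2). Otherwise four ends
  -- with at most four arcs each give 16 ≤ 2 * 10 - 3.
  by_cases hz : ∃ z, 5 ≤ #(arcsAt F z)
  · obtain ⟨z, hz⟩ := hz
    have hzS : z ∈ S := by
      obtain ⟨e, he⟩ := card_pos.1 (show 0 < #(arcsAt F z) by omega)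
      simp only [arcsAt, mem_filter] at he
      have := hF e he.1
      rcases he.2 with rfl | rfl <;> tauto
    have h1 := ho.card_arcsAt_le hF z
    have h2 : #{e ∈ F | ¬ (e.1 = z ∨ e.2 = z)} ≤ max 4 (#(S.erase z) - 1) := by
      refine ho.card_le_of_no_two_disjoint (fun e he => ?_) (fun e he f hf hef => ?_)
      · simp only [mem_filter, not_or] at he
        have := hF e he.1
        simp only [mem_erase]
        tauto
      · simp only [mem_filter, not_or] at he hf
        obtain ⟨g, hg, hA⟩ := ho.exists_arcsAt_avoiding (fun e he => (hF e he).1)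
          (A := {e.1, e.2, f.1, f.2}) (z := z) (by
            have := card_le_four (a := e.1) (b := e.2) (c := f.1) (d := f.2); omega)
        simp only [mem_insert, mem_singleton, not_or] at hA
        exact h g (mem_filter.1 hg).1 e he.1 f hf.1
          (arcDisjoint_of_otherEnd hg hA.1 hA.2.1 (Ne.symm he.2.1) (Ne.symm he.2.2))
          (arcDisjoint_of_otherEnd hg hA.2.2.1 hA.2.2.2 (Ne.symm hf.2.1) (Ne.symm hf.2.2)) hef
    have h3 := card_filter_add_card_filter_not (s := F) fun e => e.1 = z ∨ e.2 = z
    rw [card_erase_of_mem hzS] at h2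
    change #(arcsAt F z) + _ = _ at h3
    omega
  · push Not at hz
    by_cases h2 : ∃ e ∈ F, ∃ f ∈ F, ArcDisjoint e f
    · obtain ⟨e, he, f, hf, hef⟩ := h2
      have hsub : F ⊆ (arcsAt F e.1 ∪ arcsAt F e.2) ∪ (arcsAt F f.1 ∪ arcsAt F f.2) := by
        intro g hg
        have := h e he f hf g hg hef
        simp only [ArcDisjoint, arcsAt, mem_union, mem_filter] at this ⊢
        grind
      have h1 := card_le_card hsub
      have h2 := card_union_le (arcsAt F e.1 ∪ arcsAt F e.2) (arcsAt F f.1 ∪ arcsAt F f.2)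
      have h2 := card_union_le (arcsAt F e.1) (arcsAt F e.2)
      have h2 := card_union_le (arcsAt F f.1) (arcsAt F f.2)
      have h3 := hz e.1
      have h3 := hz e.2
      have h3 := hz f.1
      have h3 := hz f.2
      omega
    · push Not at h2
      have := ho.card_le_of_no_two_disjoint hF h2
      omega

end ArcSets

/-! ### The size formula and the cost of light arcs. -/

section Defect

open scoped Classical

variable {V : Type*} [Fintype V] {D : Digraph V}

/-- The arcs both of whose ends have in-degree less than `5`. -/
noncomputable def lightArcs (D : Digraph V) : Finset (V × V) :=
  {e | D.Adj e.1 e.2 ∧ e.1 ∉ D.heavy 5 ∧ e.2 ∉ D.heavy 5}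

/-- The number of in-neighbours that `w` lacks to have two heavy in-neighbours and to be adjacent
to all light vertices. -/
noncomputable def defect (D : Digraph V) (w : V) : ℕ :=
  (2 - D.degFrom (D.heavy 5) w) + #{u ∈ (D.heavy 5)ᶜ | ¬ D.Adj u w ∧ ¬ D.Adj w u}

theorem mem_lightArcs {e : V × V} :
    e ∈ D.lightArcs ↔ D.Adj e.1 e.2 ∧ e.1 ∉ D.heavy 5 ∧ e.2 ∉ D.heavy 5 := by
  simp [lightArcs]

theorem heavy_anti {k l : ℕ} (h : k ≤ l) : D.heavy l ⊆ D.heavy k := by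
  intro v
  simp only [mem_heavy]
  omega

theorem card_filter_lightArcs_head (P : V → Prop) [DecidablePred P] :
    #{e ∈ D.lightArcs | P e.2} = ∑ u ∈ (D.heavy 5)ᶜ with P u, D.degFrom (D.heavy 5)ᶜ u := by
  rw [card_eq_sum_card_fiberwise (f := Prod.snd) (t := {u ∈ (D.heavy 5)ᶜ | P u})]
  · refine sum_congr rfl fun u hu => ?_
    simp only [mem_filter, mem_compl] at hu
    refine card_bij (fun e _ => e.1) ?_ ?_ ?_
    · rintro ⟨a, b⟩ h
      simp only [mem_filter, mem_lightArcs] at h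
      obtain ⟨⟨h, -⟩, rfl⟩ := h
      simp [h]
    · rintro ⟨a, b⟩ h ⟨c, d⟩ h'
      simp only [mem_filter] at h h'
      simp [h.2, h'.2]
    · intro a ha
      simp only [mem_filter, mem_compl] at ha
      exact ⟨(a, u), by simp [mem_lightArcs, ha, hu], rfl⟩
  · intro e he
    simp only [coe_filter, Set.mem_ofPred_eq, mem_lightArcs, mem_compl] at he ⊢
    tauto

theorem card_lightArcs : #D.lightArcs = ∑ u ∈ (D.heavy 5)ᶜ, D.degFrom (D.heavy 5)ᶜ u := by
  simpa using card_filter_lightArcs_head (D := D) fun _ => True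

omit [Fintype V] in
theorem sum_degFrom_comm (A C : Finset V) :
    ∑ u ∈ C, D.degFrom A u = ∑ w ∈ A, #{u ∈ C | D.Adj w u} := by
  simp only [degFrom, card_filter]
  exact sum_comm

theorem degFrom_univ_eq (v : V) :
    D.degFrom univ v = D.degFrom (D.heavy 5) v + D.degFrom (D.heavy 5)ᶜ v :=
  (degFrom_add_degFrom_compl _ _).symm

variable (ho : D.IsOriented) (hF : ¬ D.ContainsCopy (inStar 3).subdivision)

include ho hF

theorem degFrom_add_card_add_defect (w : V) :
    D.degFrom univ w + #{u ∈ (D.heavy 5)ᶜ | D.Adj w u} + D.defect w = #(D.heavy 5)ᶜ + 2 := by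
  have h1 := degFrom_heavy_five_le ho hF w
  have h2 := card_filter_add_card_filter_not (s := (D.heavy 5)ᶜ) fun u => D.Adj u w
  have h3 := card_filter_add_card_filter_not (s := {u ∈ (D.heavy 5)ᶜ | ¬ D.Adj u w})
    fun u => D.Adj w u
  rw [filter_filter, filter_filter] at h3
  have h4 : {u ∈ (D.heavy 5)ᶜ | ¬ D.Adj u w ∧ D.Adj w u} = {u ∈ (D.heavy 5)ᶜ | D.Adj w u} :=
    filter_congr fun u _ => ⟨And.right, fun h => ⟨ho _ _ h, h⟩⟩
  rw [h4] at h3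
  rw [degFrom_univ_eq, defect]
  simp only [degFrom] at h1 ⊢
  omega

/-- Summing the previous identity over heavy w, the arcs from heavy to light vertices complete the
in-degrees of the light vertices except for the light arcs. -/
theorem size_add_sum_defect :
    D.size + ∑ w ∈ D.heavy 5, D.defect w =
      #(D.heavy 5) * (#(D.heavy 5)ᶜ + 2) + #D.lightArcs := by
  have h1 : ∑ w ∈ D.heavy 5, (D.degFrom univ w + #{u ∈ (D.heavy 5)ᶜ | D.Adj w u} + D.defect w) =
      #(D.heavy 5) * (#(D.heavy 5)ᶜ + 2) := by
    rw [sum_congr rfl fun w _ => degFrom_add_card_add_defect ho hF w, sum_const, smul_eq_mul]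
  rw [sum_add_distrib, sum_add_distrib, ← sum_degFrom_comm] at h1
  have h2 := sum_add_sum_compl (D.heavy 5) (D.degFrom univ)
  have h3 : ∑ u ∈ (D.heavy 5)ᶜ, D.degFrom univ u =
      ∑ u ∈ (D.heavy 5)ᶜ, D.degFrom (D.heavy 5) u + ∑ u ∈ (D.heavy 5)ᶜ, D.degFrom (D.heavy 5)ᶜ u := by
    rw [← sum_add_distrib]
    exact sum_congr rfl fun u _ => degFrom_univ_eq u
  rw [← card_lightArcs] at h3
  rw [size_eq_sum_degFrom]
  omega

/-- Each head in M either sends an arc to w, receives one from w, or is not adjacent to w. The first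
kind is bounded by the heavy in-neighbours that w lacks, and the last kind by the second term of the
defect, as disjoint arcs have distinct heads. -/
theorem card_le_defect_add (w : V) {M : Finset (V × V)} (hM : M ⊆ D.lightArcs)
    (hd : (M : Set (V × V)).Pairwise ArcDisjoint) :
    #M ≤ D.defect w + #{e ∈ M | D.Adj w e.2} := by
  have h1 := card_filter_add_degFrom_heavy_le ho hF w (M := M)
    (fun e he => mem_lightArcs.1 (hM he)) hd
  have h2 := card_filter_add_card_filter_not (s := M) fun e => D.Adj e.2 w
  have h3 := card_filter_add_card_filter_not (s := {e ∈ M | ¬ D.Adj e.2 w}) fun e => D.Adj w e.2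
  rw [filter_filter, filter_filter] at h3
  have h4 : #{e ∈ M | ¬ D.Adj e.2 w ∧ D.Adj w e.2} ≤ #{e ∈ M | D.Adj w e.2} :=
    card_le_card fun e => by simp only [mem_filter]; tauto
  have h5 : #{e ∈ M | ¬ D.Adj e.2 w ∧ ¬ D.Adj w e.2} ≤
      #{u ∈ (D.heavy 5)ᶜ | ¬ D.Adj u w ∧ ¬ D.Adj w u} := by
    refine card_le_card_of_injOn Prod.snd (fun e he => ?_) (fun e he f hf hef => ?_)
    · simp only [coe_filter, Set.mem_ofPred_eq, mem_compl] at he ⊢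
      exact ⟨(mem_lightArcs.1 (hM he.1)).2.2, he.2⟩
    · simp only [coe_filter, Set.mem_ofPred_eq] at he hf
      by_contra hne
      exact (hd he.1 hf.1 hne).2.2.2 hef
  unfold defect
  omega

theorem card_mul_card_heavy_le {M : Finset (V × V)} (hM : M ⊆ D.lightArcs)
    (hd : (M : Set (V × V)).Pairwise ArcDisjoint) :
    #M * #(D.heavy 5) ≤
      ∑ w ∈ D.heavy 5, D.defect w + ∑ e ∈ M, D.degFrom (D.heavy 5) e.2 := by
  have h1 : ∑ e ∈ M, D.degFrom (D.heavy 5) e.2 = ∑ w ∈ D.heavy 5, #{e ∈ M | D.Adj w e.2} := by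
    simp only [degFrom, card_filter]
    exact sum_comm
  rw [h1, ← sum_add_distrib, mul_comm, ← smul_eq_mul, ← sum_const]
  exact sum_le_sum fun w _ => card_le_defect_add ho hF w hM hd

end Defect

/-! ### Large digraphs have no light arcs. -/

section Bounds

open scoped Classical

variable {V : Type*} [Fintype V] {D : Digraph V}

/-- The head has in-degree at most 4, or at most 2 in the second case, and one of its in-neighbours
is the light tail. -/
theorem degFrom_heavy_le_of_mem_lightArcs {e : V × V} (he : e ∈ D.lightArcs) :
    D.degFrom (D.heavy 5) e.2 ≤ 3 ∧
      (e.2 ∉ D.heavy 3 → D.degFrom (D.heavy 5) e.2 ≤ 1) := by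
  obtain ⟨h1, h2, h3⟩ := mem_lightArcs.1 he
  have h4 : 0 < D.degFrom (D.heavy 5)ᶜ e.2 := card_pos.2 ⟨e.1, by simp [h1, h2]⟩
  have h5 := degFrom_univ_eq (D := D) e.2
  simp only [mem_heavy] at h3 ⊢
  omega

variable (ho : D.IsOriented) (hF : ¬ D.ContainsCopy (inStar 3).subdivision)
  (hn : 40 ≤ Fintype.card V) (hE : (Fintype.card V + 2) ^ 2 ≤ 4 * D.size + 1)

theorem filter_light_heavy_three :
    {u ∈ (D.heavy 5)ᶜ | u ∈ D.heavy 3} = D.heavy 3 \ D.heavy 5 := by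
  ext
  simp [and_comm]

theorem sum_degFrom_light_le :
    ∑ u ∈ (D.heavy 5)ᶜ, D.degFrom univ u ≤
      2 * #(D.heavy 5)ᶜ + 2 * #(D.heavy 3 \ D.heavy 5) := by
  have h1 : ∀ u ∈ (D.heavy 5)ᶜ, D.degFrom univ u ≤ 2 + if u ∈ D.heavy 3 then 2 else 0 := by
    intro u hu
    rw [mem_compl] at hu
    simp only [mem_heavy] at hu ⊢
    split_ifs <;> omega
  refine (sum_le_sum h1).trans ?_
  rw [sum_add_distrib, sum_const, smul_eq_mul, ← sum_filter, sum_const, smul_eq_mul]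
  rw [filter_light_heavy_three]
  omega

theorem card_heavy_add_card_light : #(D.heavy 5) + #(D.heavy 5)ᶜ = Fintype.card V :=
  card_add_card_compl _

include ho hF hn hE

theorem card_medium_le : #(D.heavy 3 \ D.heavy 5) ≤ 3 := by
  by_contra! hm
  have h1 := size_eq_sum_degFrom (D := D)
  rw [← sum_add_sum_compl (D.heavy 5)] at h1
  have h2 := sum_degFrom_light_le (D := D)
  have h3 : ∑ w ∈ D.heavy 5, D.degFrom univ w ≤ #(D.heavy 5) * (#(D.heavy 3)ᶜ + 3) := by
    rw [← smul_eq_mul, ← sum_const]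
    refine sum_le_sum fun w _ => ?_
    rw [← degFrom_add_degFrom_compl (D.heavy 3) w, add_comm]
    exact Nat.add_le_add (card_filter_le _ _) (degFrom_heavy_three_le ho hF w)
  have h4 := card_sdiff_add_card_eq_card (heavy_anti (D := D) (show 3 ≤ 5 by norm_num))
  have h5 := card_heavy_add_card_light (D := D)
  have h6 := card_add_card_compl (D.heavy 3)
  generalize #(D.heavy 5) = b at *
  generalize #(D.heavy 3 \ D.heavy 5) = m at *
  generalize #(D.heavy 3)ᶜ = t at *
  have h7 : #(D.heavy 5)ᶜ = m + t := by omega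
  rw [h7] at h2
  have h8 : Fintype.card V = b + m + t := by omega
  rw [h8] at hE hn
  have h9 : D.size ≤ b * (t + 3) + 4 * m + 2 * t := by omega
  zify at *
  -- The bound on the size is (b + 2)(t + 3) + 4m - 6, largest for fixed m when b + 2 = t + 3.
  nlinarith [sq_nonneg ((b : ℤ) - t - 1),
    mul_nonneg (show (0 : ℤ) ≤ m - 3 by omega) (show (0 : ℤ) ≤ 2 * b + m + 2 * t - 40 by omega)]

theorem sum_degFrom_light_le_add_six :
    ∑ u ∈ (D.heavy 5)ᶜ, D.degFrom univ u ≤ 2 * #(D.heavy 5)ᶜ + 6 := by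
  have h1 := sum_degFrom_light_le (D := D)
  have h2 := card_medium_le ho hF hn hE
  omega

theorem card_lightArcs_le : #D.lightArcs ≤ 2 * #(D.heavy 5)ᶜ + 6 := by
  refine le_trans ?_ (sum_degFrom_light_le_add_six ho hF hn hE)
  rw [card_lightArcs]
  exact sum_le_sum fun u _ => by rw [degFrom_univ_eq]; omega

theorem sum_degFrom_medium_le :
    ∑ u ∈ D.heavy 3 \ D.heavy 5, (D.degFrom (D.heavy 5) u + D.degFrom (D.heavy 5)ᶜ u) ≤ 12 := by
  refine (sum_le_card_nsmul _ _ 4 fun u hu => ?_).trans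
    (Nat.mul_le_mul_right 4 (card_medium_le ho hF hn hE))
  rw [← degFrom_univ_eq]
  simp only [mem_sdiff, mem_heavy] at hu
  omega

/-- The size is at most (b + 2)(s + 2) + 2, too small when s ≤ 13. The hypothesis n ≥ 40 is tight
for this estimate: with s = 13 it gives 437 < 441 at n = 40, but 422 > 420 at n = 39. -/
theorem card_light_ge : 14 ≤ #(D.heavy 5)ᶜ := by
  by_contra! hs
  have h1 := size_eq_sum_degFrom (D := D)
  rw [← sum_add_sum_compl (D.heavy 5)] at h1
  have h2 := sum_degFrom_light_le_add_six ho hF hn hE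
  have h3 : ∑ w ∈ D.heavy 5, D.degFrom univ w ≤ #(D.heavy 5) * (#(D.heavy 5)ᶜ + 2) := by
    rw [← smul_eq_mul, ← sum_const]
    exact sum_le_sum fun w _ => by have := degFrom_add_card_add_defect ho hF w; omega
  have h5 := card_heavy_add_card_light (D := D)
  rw [← h5] at hE hn
  generalize #(D.heavy 5) = b at *
  generalize #(D.heavy 5)ᶜ = s at *
  have h9 : D.size ≤ b * (s + 2) + 2 * s + 6 := by omega
  zify at *
  nlinarith [mul_nonneg (show (0 : ℤ) ≤ 13 - s by omega) (show (0 : ℤ) ≤ b - s - 14 by omega),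
    mul_nonneg (show (0 : ℤ) ≤ 13 - s by omega) (show (0 : ℤ) ≤ b + s - 40 by omega),
    mul_nonneg (show (0 : ℤ) ≤ b - 27 by omega) (show (0 : ℤ) ≤ b + s - 40 by omega)]

theorem not_three_disjoint {e f g : V × V} (he : e ∈ D.lightArcs) (hf : f ∈ D.lightArcs)
    (hg : g ∈ D.lightArcs) (hef : ArcDisjoint e f) (heg : ArcDisjoint e g) :
    ¬ ArcDisjoint f g := by
  intro hfg
  have h1 : e ≠ f := fun h => hef.1 (h ▸ rfl)
  have h2 : e ≠ g := fun h => heg.1 (h ▸ rfl)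
  have h3 : f ≠ g := fun h => hfg.1 (h ▸ rfl)
  have key := card_mul_card_heavy_le ho hF (M := {e, f, g}) (by simp [insert_subset_iff, *]) (by
    intro x hx y hy hxy
    simp only [coe_insert, coe_singleton, Set.mem_insert_iff, Set.mem_singleton_iff] at hx hy
    rcases hx with rfl | rfl | rfl <;> rcases hy with rfl | rfl | rfl <;>
      first | exact absurd rfl hxy | assumption | (apply ArcDisjoint.symm; assumption))
  rw [sum_insert (by simp [*]), sum_insert (by simp [*]), sum_singleton,
    card_eq_three.2 ⟨e, f, g, h1, h2, h3, rfl⟩] at key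
  have k1 := (degFrom_heavy_le_of_mem_lightArcs he).1
  have k2 := (degFrom_heavy_le_of_mem_lightArcs hf).1
  have k3 := (degFrom_heavy_le_of_mem_lightArcs hg).1
  have k4 := card_lightArcs_le ho hF hn hE
  have k5 := size_add_sum_defect ho hF
  rw [← card_heavy_add_card_light (D := D)] at hE hn
  generalize #(D.heavy 5) = b at *
  generalize #(D.heavy 5)ᶜ = s at *
  have h9 : D.size + 3 * b ≤ b * (s + 2) + 2 * s + 15 := by omega
  zify at *
  nlinarith [sq_nonneg ((b : ℤ) - s + 3)]

theorem not_two_disjoint {e f : V × V} (he : e ∈ D.lightArcs) (hf : f ∈ D.lightArcs) :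
    ¬ ArcDisjoint e f := by
  have key : ∀ e ∈ D.lightArcs, ∀ f ∈ D.lightArcs, ArcDisjoint e f →
      2 * #(D.heavy 5) ≤ ∑ w ∈ D.heavy 5, D.defect w +
        (D.degFrom (D.heavy 5) e.2 + D.degFrom (D.heavy 5) f.2) := by
    intro e he f hf hef
    have h1 : e ≠ f := fun h => hef.1 (h ▸ rfl)
    have key := card_mul_card_heavy_le ho hF (M := {e, f}) (by simp [insert_subset_iff, *]) (by
      intro x hx y hy hxy
      simp only [coe_insert, coe_singleton, Set.mem_insert_iff, Set.mem_singleton_iff] at hx hy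
      rcases hx with rfl | rfl <;> rcases hy with rfl | rfl <;>
        first | exact absurd rfl hxy | assumption | (apply ArcDisjoint.symm; assumption))
    rwa [sum_pair h1, card_pair h1] at key
  have k5 := size_add_sum_defect ho hF
  have hs := card_light_ge ho hF hn hE
  have hmem : ∀ e ∈ D.lightArcs, D.Adj e.1 e.2 ∧ e.1 ∈ (D.heavy 5)ᶜ ∧ e.2 ∈ (D.heavy 5)ᶜ := by
    intro e he
    simpa using mem_lightArcs.1 he
  -- If the light arcs and j together fell short of 2s, the size would be at most (b + 2)s - 1,
  -- below the assumed value.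
  suffices hlt : ∀ j, 2 * #(D.heavy 5) ≤ ∑ w ∈ D.heavy 5, D.defect w + j →
      2 * #(D.heavy 5)ᶜ ≤ #D.lightArcs + j by
    intro hef
    by_cases h2 : ∃ e' ∈ D.lightArcs, ∃ f' ∈ D.lightArcs, ArcDisjoint e' f' ∧
        e'.2 ∉ D.heavy 3 ∧ f'.2 ∉ D.heavy 3
    · obtain ⟨e', he', f', hf', hef', h3, h4⟩ := h2
      have h5 := hlt _ (key e' he' f' hf' hef')
      have h6 := (degFrom_heavy_le_of_mem_lightArcs he').2 h3
      have h7 := (degFrom_heavy_le_of_mem_lightArcs hf').2 h4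
      have h8 := ho.card_le_of_no_three_disjoint (by omega) hmem
        (fun e he f hf g hg => not_three_disjoint ho hF hn hE he hf hg)
      omega
    -- Light arcs with heads of in-degree at most 2 are now pairwise intersecting, so at most s - 1.
    -- The other light arcs and the heavy in-arcs at their heads share the budget 12, and the two
    -- chosen heads add at most 2: in all s + 13 < 2s, which is where s ≥ 14 enters.
    · push Not at h2
      have h5 := hlt _ (key e he f hf hef)
      have h6 : #{e ∈ D.lightArcs | ¬ e.2 ∈ D.heavy 3} ≤ max 4 (#(D.heavy 5)ᶜ - 1) := by
        refine ho.card_le_of_no_two_disjoint (fun e he => hmem e (mem_filter.1 he).1)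
          (fun e he f hf hef => ?_)
        rw [mem_filter] at he hf
        exact hf.2 (h2 e he.1 f hf.1 hef he.2)
      have h7 := card_filter_add_card_filter_not (s := D.lightArcs) fun e => e.2 ∈ D.heavy 3
      have h8 := card_filter_lightArcs_head (D := D) fun u => u ∈ D.heavy 3
      rw [filter_light_heavy_three] at h8
      have h10 := sum_degFrom_medium_le ho hF hn hE
      rw [sum_add_distrib] at h10
      have h11 : D.degFrom (D.heavy 5) e.2 + D.degFrom (D.heavy 5) f.2 ≤
          ∑ u ∈ D.heavy 3 \ D.heavy 5, D.degFrom (D.heavy 5) u + 2 := by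
        have h12 : ∑ u ∈ {e.2, f.2}, D.degFrom (D.heavy 5) u ≤
            ∑ u ∈ {e.2, f.2}, ((if u ∈ D.heavy 3 then D.degFrom (D.heavy 5) u else 0) + 1) := by
          refine sum_le_sum fun u hu => ?_
          split_ifs with h
          · omega
          · simp only [mem_insert, mem_singleton] at hu
            rcases hu with rfl | rfl
            · simpa using (degFrom_heavy_le_of_mem_lightArcs he).2 h
            · simpa using (degFrom_heavy_le_of_mem_lightArcs hf).2 h
        rw [sum_pair hef.2.2.2, sum_add_distrib, ← sum_filter, sum_const, smul_eq_mul, mul_one,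
          card_pair hef.2.2.2] at h12
        refine h12.trans (Nat.add_le_add_right (sum_le_sum_of_subset fun u hu => ?_) 2)
        simp only [mem_filter, mem_insert, mem_singleton] at hu
        rw [mem_sdiff]
        refine ⟨hu.2, ?_⟩
        rcases hu.1 with rfl | rfl
        · exact (mem_lightArcs.1 he).2.2
        · exact (mem_lightArcs.1 hf).2.2
      omega
  intro j hj
  by_contra! hlt
  rw [← card_heavy_add_card_light (D := D)] at hE
  generalize #(D.heavy 5) = b at *
  generalize #(D.heavy 5)ᶜ = s at *
  have h9 : D.size + 1 ≤ b * (s + 2) + 2 * s - 2 * b := by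
    have : 2 * b ≤ b * (s + 2) := by nlinarith
    omega
  have h10 : b * (s + 2) + 2 * s - 2 * b = (b + 2) * s := by
    have : b * (s + 2) + 2 * s = (b + 2) * s + 2 * b := by ring
    omega
  zify at *
  nlinarith [sq_nonneg ((b : ℤ) + 2 - s)]

theorem lightArcs_eq_empty : D.lightArcs = ∅ := by
  by_contra hne
  obtain ⟨e, he⟩ := nonempty_iff_ne_empty.2 hne
  have key : ∀ e ∈ D.lightArcs, #(D.heavy 5) ≤ ∑ w ∈ D.heavy 5, D.defect w +
        D.degFrom (D.heavy 5) e.2 := by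
    intro e he
    simpa using card_mul_card_heavy_le ho hF (M := {e}) (by simpa using he) (by simp)
  have k5 := size_add_sum_defect ho hF
  have hs := card_light_ge ho hF hn hE
  -- Such a j bounds the size by (b + 1)(s + 1) - 1, again too small.
  suffices hlt : ∃ j, #(D.heavy 5) ≤ ∑ w ∈ D.heavy 5, D.defect w + j ∧
      #D.lightArcs + j ≤ #(D.heavy 5)ᶜ by
    obtain ⟨j, hj, hlt⟩ := hlt
    rw [← card_heavy_add_card_light (D := D)] at hE
    generalize #(D.heavy 5) = b at *
    generalize #(D.heavy 5)ᶜ = s at *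
    have h9 : D.size + b ≤ b * (s + 2) + s := by omega
    zify at *
    nlinarith [sq_nonneg ((b : ℤ) - s)]
  by_cases h2 : ∃ e' ∈ D.lightArcs, e'.2 ∉ D.heavy 3
  · obtain ⟨e', he', h3⟩ := h2
    refine ⟨_, key e' he', ?_⟩
    have h6 := (degFrom_heavy_le_of_mem_lightArcs he').2 h3
    have h8 := ho.card_le_of_no_two_disjoint (F := D.lightArcs) (S := (D.heavy 5)ᶜ)
      (fun e he => by simpa using mem_lightArcs.1 he)
      (fun e he f hf => not_two_disjoint ho hF hn hE he hf)
    omega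
  · push Not at h2
    refine ⟨_, key e he, ?_⟩
    have h6 := (degFrom_heavy_le_of_mem_lightArcs he).1
    have h8 := card_filter_lightArcs_head (D := D) fun u => u ∈ D.heavy 3
    rw [filter_true_of_mem h2] at h8
    rw [filter_light_heavy_three] at h8
    have h10 := sum_degFrom_medium_le ho hF hn hE
    rw [sum_add_distrib] at h10
    have h11 := single_le_sum_of_canonicallyOrdered (f := D.degFrom (D.heavy 5))
      (mem_sdiff.2 ⟨h2 e he, (mem_lightArcs.1 he).2.2⟩)
    omega

end Bounds

/-! ### Structure of extremal digraphs, and the converse. -/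

section Extremal

open scoped Classical

variable {V : Type*} [Fintype V] {D : Digraph V}

omit [Fintype V] in
theorem inDegree_inducedOn (Y : Set V) (v : Y) :
    (D.inducedOn Y).inDegree v = {u | u ∈ Y ∧ D.Adj u v}.ncard := by
  rw [inDegree, ← Set.ncard_image_of_injective _ Subtype.val_injective]
  congr 1
  ext u
  simp [inducedOn, and_comm]

theorem inDegree_inducedOn_coe (A : Finset V) (v : (A : Set V)) :
    (D.inducedOn (A : Set V)).inDegree v = D.degFrom A v := by
  have : {u | u ∈ (A : Set V) ∧ D.Adj u v} = (A.filter fun u => D.Adj u v) := by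
    ext; simp
  rw [inDegree_inducedOn, this, Set.ncard_coe_finset, degFrom]

omit [Fintype V] in
/-- A finite oriented graph all of whose in-degrees are `2` has at least five vertices. -/
theorem IsOriented.five_le_card (ho : D.IsOriented) {A : Finset V} (hA : A.Nonempty)
    (h2 : ∀ a ∈ A, D.degFrom A a = 2) : 5 ≤ #A := by
  have h1 : ∑ a ∈ A, (D.degFrom A a + #{u ∈ A | D.Adj a u}) ≤ #A * (#A - 1) := by
    refine sum_le_card_nsmul _ _ _ fun a ha => ?_
    rw [degFrom, ← card_erase_of_mem ha, ← card_union_of_disjoint]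
    · refine card_le_card fun u hu => ?_
      simp only [mem_union, mem_filter] at hu
      rcases hu with hu | hu
      · exact mem_erase.2 ⟨ho.ne hu.2, hu.1⟩
      · exact mem_erase.2 ⟨(ho.ne hu.2).symm, hu.1⟩
    · exact disjoint_filter.2 fun u _ h => ho _ _ h
  rw [sum_add_distrib, ← sum_degFrom_comm, sum_congr rfl h2, sum_const, smul_eq_mul] at h1
  have h3 := card_pos.2 hA
  have : 4 ≤ #A - 1 := by
    refine Nat.le_of_mul_le_mul_left ?_ h3
    omega
  omega

theorem exists_partition_of_large (ho : D.IsOriented)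
    (hF : ¬ D.ContainsCopy (inStar 3).subdivision) (hn : 40 ≤ Fintype.card V)
    (hE : (Fintype.card V + 2) ^ 2 ≤ 4 * D.size + 1) :
    D.size = (Fintype.card V + 2) ^ 2 / 4 ∧ ∃ X Y : Set V, IsCompl X Y ∧
      (X.ncard = Fintype.card V / 2 - 1 ∨ X.ncard = (Fintype.card V + 1) / 2 - 1) ∧
      (∀ x ∈ X, ∀ y ∈ Y, D.Adj x y) ∧ D.inducedOn X = ⊥ ∧
      (D.inducedOn Y).IsInDegreeRegular 2 := by
  have hH := lightArcs_eq_empty ho hF hn hE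
  have hsz := size_add_sum_defect ho hF
  have hbs := card_heavy_add_card_light (D := D)
  rw [hH, card_empty, add_zero] at hsz
  have hdef : ∑ w ∈ D.heavy 5, D.defect w = 0 := by
    rw [← hbs] at hE
    generalize #(D.heavy 5) = b at *
    generalize #(D.heavy 5)ᶜ = s at *
    generalize ∑ w ∈ D.heavy 5, D.defect w = g at *
    zify at *
    nlinarith [sq_nonneg ((b : ℤ) - s - 2)]
  rw [hdef, add_zero] at hsz
  -- The square measures the imbalance between b and s + 2; being at most 1, it fixes both the size
  -- and the part sizes.
  have hsum : (Fintype.card V + 2) ^ 2 =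
      4 * D.size + ((#(D.heavy 5) : ℤ) - #(D.heavy 5)ᶜ - 2) ^ 2 := by
    rw [← hbs, hsz]
    push_cast
    ring
  have hdiff : ((#(D.heavy 5) : ℤ) - #(D.heavy 5)ᶜ - 2) ^ 2 ≤ 1 := by
    zify at hE
    linarith
  have hdiff' := abs_le.1 ((sq_le_one_iff_abs_le_one _).1 hdiff)
  refine ⟨?_, ?_⟩
  · have := sq_nonneg ((#(D.heavy 5) : ℤ) - #(D.heavy 5)ᶜ - 2)
    zify at *
    omega
  have hw : ∀ w ∈ D.heavy 5, D.degFrom (D.heavy 5) w = 2 ∧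
      ∀ u ∉ D.heavy 5, D.Adj u w ∨ D.Adj w u := by
    intro w hw
    have h1 := sum_eq_zero_iff.1 hdef w hw
    have h2 := degFrom_heavy_five_le ho hF w
    simp only [defect, Nat.add_eq_zero_iff, card_eq_zero, filter_eq_empty_iff, mem_compl] at h1
    refine ⟨by omega, fun u hu => ?_⟩
    have := h1.2 hu
    tauto
  have hback : ∀ u ∉ D.heavy 5, ∀ w ∈ D.heavy 5, ¬ D.Adj w u := by
    intro u hu w hwB hwu
    -- If u → x instead, the two heavy in-neighbours of x and the arc a → u complete a copy centered
    -- at x; a is not one of those two because x → a.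
    have hclosed : ∀ a ∈ D.heavy 5, D.Adj a u → ∀ x ∈ D.heavy 5, D.Adj x a → D.Adj x u := by
      intro a ha hau x hx hxa
      refine ((hw x hx).2 u hu).resolve_left fun hux => ?_
      obtain ⟨p, q, hpq, hpq'⟩ := card_eq_two.1 (hw x hx).1
      have hp : p ∈ ({v ∈ D.heavy 5 | D.Adj v x} : Finset V) := by rw [hpq']; simp
      have hq : q ∈ ({v ∈ D.heavy 5 | D.Adj v x} : Finset V) := by rw [hpq']; simp
      rw [mem_filter] at hp hq
      have hne : ∀ r, D.Adj r x → r ≠ a := by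
        rintro r hr rfl
        exact ho _ _ hr hxa
      have hne' : ∀ r ∈ D.heavy 5, r ≠ u := by
        rintro r hr rfl
        exact hu hr
      exact false_of_heavy_heavy_arc ho hF (e := (a, u)) hp.1 hp.2 hq.1 hq.2 hpq hau hux
        (hne p hp.2) (hne' p hp.1) (hne q hq.2) (hne' q hq.1)
    have h5 := ho.five_le_card (A := {a ∈ D.heavy 5 | D.Adj a u})
      ⟨w, mem_filter.2 ⟨hwB, hwu⟩⟩ (by
        intro a ha
        rw [mem_filter] at ha
        rw [← (hw a ha.1).1, degFrom, degFrom, filter_filter]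
        refine congrArg card (filter_congr fun x hx => ⟨And.right, fun h => ⟨?_, h⟩⟩)
        exact hclosed a ha.1 ha.2 x hx h)
    have h6 := degFrom_univ_eq (D := D) u
    rw [mem_heavy] at hu
    change 5 ≤ D.degFrom (D.heavy 5) u at h5
    omega
  refine ⟨((D.heavy 5)ᶜ : Finset V), (D.heavy 5 : Finset V), ?_, ?_, ?_, ?_, ?_⟩
  · rw [coe_compl]
    exact isCompl_compl.symm
  · rw [Set.ncard_coe_finset]
    omega
  · intro x hx y hy
    simp only [coe_compl, Set.mem_compl_iff, Finset.mem_coe] at hx hy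
    exact ((hw y hy).2 x hx).resolve_right (hback x hx y hy)
  · ext ⟨u, hu⟩ ⟨v, hv⟩
    simp only [coe_compl, Set.mem_compl_iff, Finset.mem_coe] at hu hv
    change D.Adj u v ↔ False
    refine ⟨fun h => ?_, False.elim⟩
    have := mem_lightArcs.2 (show D.Adj (u, v).1 (u, v).2 ∧ _ from ⟨h, hu, hv⟩)
    simp [hH] at this
  · intro v
    rw [inDegree_inducedOn_coe]
    exact (hw v v.2).1

section Converse

variable {X Y : Set V} (ho : D.IsOriented) (hXY : IsCompl X Y)
  (hadj : ∀ x ∈ X, ∀ y ∈ Y, D.Adj x y) (hX : D.inducedOn X = ⊥)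
  (hY : (D.inducedOn Y).IsInDegreeRegular 2)

include ho hXY hadj hX

omit [Fintype V] in
theorem not_adj_of_mem {u v : V} (hv : v ∈ X) : ¬ D.Adj u v := by
  intro h
  by_cases hu : u ∈ X
  · have h1 : (D.inducedOn X).Adj ⟨u, hu⟩ ⟨v, hv⟩ := h
    rw [hX] at h1
    exact h1
  · rw [← Set.mem_compl_iff, hXY.compl_eq] at hu
    exact ho _ _ h (hadj v hv u hu)

include hY

/-- Vertices of X are sources, so the three middle vertices of a copy would be in-neighbours of its
center inside Y, where there are only two. -/
theorem not_containsCopy_of_partition : ¬ D.ContainsCopy (inStar 3).subdivision := by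
  intro hc
  obtain ⟨v, u, hu, huv, hw⟩ := exists_of_containsCopy hc
  have hmem : ∀ x y, D.Adj x y → y ∈ Y := by
    intro x y h
    rw [← hXY.compl_eq]
    exact fun hy => not_adj_of_mem ho hXY hadj hX hy h
  have h1 := hY ⟨v, hmem _ _ (huv 0)⟩
  rw [inDegree_inducedOn] at h1
  have h2 : Set.range u ⊆ {x | x ∈ Y ∧ D.Adj x v} := by
    rintro _ ⟨i, rfl⟩
    obtain ⟨w, hw⟩ := hw i
    exact ⟨hmem _ _ hw, huv i⟩
  have h3 := Set.ncard_le_ncard h2 (Set.toFinite _)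
  rw [← Set.image_univ, Set.ncard_image_of_injective _ hu, Set.ncard_univ, Nat.card_fin, h1] at h3
  omega

theorem size_of_partition : D.size = (X.ncard + 2) * Y.ncard := by
  obtain ⟨A, rfl⟩ := X.toFinite.exists_finset_coe
  obtain rfl : ((Aᶜ : Finset V) : Set V) = Y := by rw [coe_compl, hXY.compl_eq]
  rw [size_eq_sum_degFrom, ← sum_add_sum_compl A, Set.ncard_coe_finset, Set.ncard_coe_finset]
  have h1 : ∑ v ∈ A, D.degFrom univ v = 0 := by
    refine sum_eq_zero fun v hv => card_eq_zero.2 (filter_eq_empty_iff.2 fun u _ => ?_)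
    exact not_adj_of_mem ho hXY hadj hX hv
  have h2 : ∀ v ∈ Aᶜ, D.degFrom univ v = #A + 2 := by
    intro v hv
    have h3 := hY ⟨v, hv⟩
    rw [inDegree_inducedOn_coe] at h3
    rw [← degFrom_add_degFrom_compl A, h3, degFrom,
      filter_true_of_mem fun u hu => hadj u hu v hv]
  rw [h1, sum_congr rfl h2, sum_const, smul_eq_mul, zero_add, mul_comm]

theorem size_of_balanced_partition (hV : 2 ≤ Fintype.card V)
    (hc : X.ncard = Fintype.card V / 2 - 1 ∨ X.ncard = (Fintype.card V + 1) / 2 - 1) :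
    D.size = (Fintype.card V + 2) ^ 2 / 4 := by
  have h1 := size_of_partition ho hXY hadj hX hY
  have h2 := Set.ncard_add_ncard_compl X
  rw [hXY.compl_eq, Nat.card_eq_fintype_card] at h2
  have h3 : (Fintype.card V + 2) ^ 2 =
      4 * D.size + ((Y.ncard : ℤ) - X.ncard - 2) ^ 2 := by
    rw [← h2, h1]
    push_cast
    ring
  have h4 : ((Y.ncard : ℤ) - X.ncard - 2) ^ 2 ≤ 1 :=
    (sq_le_one_iff_abs_le_one _).2 (abs_le.2 (by omega))
  have := sq_nonneg ((Y.ncard : ℤ) - X.ncard - 2)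
  zify
  omega

end Converse

end Extremal

/-! ### The circulant example and the extremal number. -/

section Construction

/-- All arcs from `Fin a` to `ZMod b`, together with the arcs from each `i : ZMod b` to `i + 1`
and `i + 2`. -/
def circulantJoin (a b : ℕ) : Digraph (Fin a ⊕ ZMod b) where
  Adj
    | .inl _, .inr _ => True
    | .inr i, .inr j => j = i + 1 ∨ j = i + 2
    | _, _ => False

theorem natCast_ne_zero_of_lt {b k : ℕ} (hk : 0 < k) (hb : k < b) : (k : ZMod b) ≠ 0 := by
  rw [Ne, ZMod.natCast_eq_zero_iff]
  exact fun h => absurd (Nat.le_of_dvd hk h) (by omega)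

/-- Opposite arcs would make a sum of two steps from {1, 2}, that is 2, 3 or 4, vanish modulo b. -/
theorem isOriented_circulantJoin {a b : ℕ} (hb : 5 ≤ b) : (circulantJoin a b).IsOriented := by
  have h2 := natCast_ne_zero_of_lt (b := b) (k := 2) (by omega) (by omega)
  have h3 := natCast_ne_zero_of_lt (b := b) (k := 3) (by omega) (by omega)
  have h4 := natCast_ne_zero_of_lt (b := b) (k := 4) (by omega) (by omega)
  push_cast at h2 h3 h4
  rintro (i | i) (j | j) h h'
  · exact h
  · exact h'
  · exact h
  · rcases h with rfl | rfl <;> rcases h' with h' | h'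
    · exact h2 (by linear_combination -h')
    · exact h3 (by linear_combination -h')
    · exact h3 (by linear_combination -h')
    · exact h4 (by linear_combination -h')

theorem isInDegreeRegular_circulantJoin {a b : ℕ} (hb : 5 ≤ b) :
    ((circulantJoin a b).inducedOn (Set.range Sum.inr)).IsInDegreeRegular 2 := by
  have : NeZero b := ⟨by omega⟩
  have h1 := natCast_ne_zero_of_lt (b := b) (k := 1) (by omega) (by omega)
  push_cast at h1
  rintro ⟨_, j, rfl⟩
  rw [inDegree_inducedOn]
  have : {u | u ∈ Set.range Sum.inr ∧ (circulantJoin a b).Adj u (Sum.inr j)} =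
      {Sum.inr (j - 1), Sum.inr (j - 2)} := by
    ext u
    constructor
    · rintro ⟨⟨i, rfl⟩, h | h⟩
      · left; simp [h]
      · right; simp [h]
    · rintro (rfl | rfl)
      · exact ⟨⟨_, rfl⟩, Or.inl (by ring)⟩
      · exact ⟨⟨_, rfl⟩, Or.inr (by ring)⟩
  rw [this, Set.ncard_pair]
  intro h
  exact h1 (by linear_combination Sum.inr_injective h)

theorem exists_oriented_of_size {n : ℕ} (hn : 8 ≤ n) :
    ∃ D : Digraph (Fin n), D.IsOriented ∧ ¬ D.ContainsCopy (inStar 3).subdivision ∧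
      D.size = (n + 2) ^ 2 / 4 := by
  have hb : 5 ≤ n - (n / 2 - 1) := by omega
  have : NeZero (n - (n / 2 - 1)) := ⟨by omega⟩
  let C := circulantJoin (n / 2 - 1) (n - (n / 2 - 1))
  have hcard : Fintype.card (Fin (n / 2 - 1) ⊕ ZMod (n - (n / 2 - 1))) = n := by
    rw [Fintype.card_sum, Fintype.card_fin, ZMod.card]
    omega
  have ho : C.IsOriented := isOriented_circulantJoin hb
  have hXY : IsCompl (Set.range (Sum.inl : Fin (n / 2 - 1) → _ ⊕ ZMod (n - (n / 2 - 1))))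
      (Set.range Sum.inr) := Set.isCompl_range_inl_range_inr
  have hadj : ∀ x ∈ Set.range Sum.inl, ∀ y ∈ Set.range Sum.inr, C.Adj x y := by
    rintro _ ⟨i, rfl⟩ _ ⟨j, rfl⟩
    trivial
  have hX : C.inducedOn (Set.range Sum.inl) = ⊥ := by
    ext ⟨_, i, rfl⟩ ⟨_, j, rfl⟩
    exact Iff.rfl
  have hY := isInDegreeRegular_circulantJoin (a := n / 2 - 1) hb
  let e := Fintype.equivFinOfCardEq hcard
  refine ⟨⟨fun i j => C.Adj (e.symm i) (e.symm j)⟩, fun i j => ho _ _, ?_, ?_⟩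
  · rintro ⟨f, hf, h⟩
    exact not_containsCopy_of_partition ho hXY hadj hX hY
      ⟨e.symm ∘ f, e.symm.injective.comp hf, h⟩
  · have h1 := size_of_balanced_partition ho hXY hadj hX hY (by omega) (by
      left
      rw [← Set.image_univ, Set.ncard_image_of_injective _ Sum.inl_injective, Set.ncard_univ,
        Nat.card_fin, hcard])
    rw [hcard] at h1
    rw [← h1, size, size,
      ← Set.ncard_image_of_injective _ (e.symm.injective.prodMap e.symm.injective)]
    congr 1
    ext ⟨x, y⟩
    constructor
    · rintro ⟨⟨i, j⟩, h, hij⟩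
      simp only [Prod.map_apply, Prod.mk.injEq] at hij
      rw [← hij.1, ← hij.2]
      exact h
    · intro h
      exact ⟨(e x, e y), by simpa using h, by simp⟩

end Construction

theorem size_le_of_not_containsCopy {V : Type*} [Fintype V] {D : Digraph V} (ho : D.IsOriented)
    (hF : ¬ D.ContainsCopy (inStar 3).subdivision) (hn : 40 ≤ Fintype.card V) :
    D.size ≤ (Fintype.card V + 2) ^ 2 / 4 := by
  by_contra! h
  have := (exists_partition_of_large ho hF hn (by omega)).1
  omega

/-- Squares are 0 or 1 modulo 4, so the + 1 absorbs the rounding of the floor. -/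
theorem four_mul_sq_div_four (m : ℕ) : m ^ 2 ≤ 4 * (m ^ 2 / 4) + 1 := by
  rcases Nat.even_or_odd' m with ⟨k, rfl | rfl⟩
  · have : (2 * k) ^ 2 = 4 * k ^ 2 := by ring
    omega
  · have : (2 * k + 1) ^ 2 = 4 * (k ^ 2 + k) + 1 := by ring
    omega

theorem exOri_subdivision_inStar {n : ℕ} (hn : 40 ≤ n) :
    exOri n (inStar 3).subdivision = (n + 2) ^ 2 / 4 := by
  refine IsGreatest.csSup_eq ⟨exists_oriented_of_size (by omega), ?_⟩
  rintro _ ⟨D, ho, hF, rfl⟩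
  simpa using size_le_of_not_containsCopy ho hF (by simpa using hn)

end Digraph

theorem theorem1p2 (n : ℕ) (hn : 40 ≤ n) :
    Digraph.exOri n (Digraph.inStar 3).subdivision = (n + 2) ^ 2 / 4 ∧
    ∀ (V : Type*) [Fintype V] (_ : Fintype.card V = n) (D : Digraph V) (_ : D.IsOriented),
      D.IsExtremalOri n (Digraph.inStar 3).subdivision ↔
        ∃ X Y : Set V, IsCompl X Y ∧
          (X.ncard = n / 2 - 1 ∨ X.ncard = (n + 1) / 2 - 1) ∧
          (∀ x ∈ X, ∀ y ∈ Y, D.Adj x y) ∧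
          D.inducedOn X = ⊥ ∧
          (D.inducedOn Y).IsInDegreeRegular 2 := by
  have hex := Digraph.exOri_subdivision_inStar hn
  refine ⟨hex, ?_⟩
  rintro V _ rfl D ho
  constructor
  · rintro ⟨-, -, hF, hsize⟩
    refine (Digraph.exists_partition_of_large ho hF hn ?_).2
    rw [hsize, hex]
    exact Digraph.four_mul_sq_div_four _
  · rintro ⟨X, Y, hXY, hc, hadj, hX, hY⟩
    refine ⟨Nat.card_eq_fintype_card, ho,
      Digraph.not_containsCopy_of_partition ho hXY hadj hX hY, ?_⟩
    rw [hex]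
    exact Digraph.size_of_balanced_partition ho hXY hadj hX hY (by omega) hc
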